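/- (Constructive statement.) Let $\mathsf{Brw}$ be the set of Brouwer ordinals: it is generated, simultaneously with its order relation $\le$, by $0$, successors $\mathsf{suc}\,a$ and limits $\lim f$ of sequences $f:\mathbb N\to\mathsf{Brw}$ with $\mathsf{suc}(f_n)\le f_{n+1}$ for all $n$, where $\le$ is the least transitive relation for which $0$ is least, $\mathsf{suc}$ is monotone and $\lim f$ is a least upper bound of the $f_n$, and limits of bisimilar sequences (each term of either sequence is $\le$ some term of the other) are equal. A proposition $Q$ is *semidecidable* if $\exists s:\mathbb N\to\{0,1\}.\ (Q\leftrightarrow\exists i.\,s_i=1)$, and *$\alpha$-decidable*, for $\alpha\in\mathsf{Brw}$, if $\exists y\in\mathsf{Brw}.\ (Q\leftrightarrow\alpha\le y)$. **Theorem.** Let $P_0,P_1,P_2,\dots$ be semidecidable propositions. Then $\exists n.\,P_n$ is $(\omega\cdot 3)$-decidable. More precisely, the characteristic ordinal $\Psi(P)$ exists, and $$(\exists n.\,P_n)\ \longleftrightarrow\ \omega\cdot 3\le\Psi(P).$$ Here $\Psi(P):=\lim_n(\Psi_n(P)+n)$ and $\Psi_n(P):=\lim_k(\omega\cdot t_k+k)$,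 where $t_k$ is the number of $i<n$ such that $s^i_j=1$ for some $j\le k$, for any binary sequences $s^0,\dots,s^{n-1}$ that semidecide $P_0,\dots,P_{n-1}$. In two-valued logic every proposition is decidable and the first assertion would be empty. The theorem is therefore asserted in the intuitionistic internal logic of the topos of sheaves on an arbitrary frame (complete Heyting algebra) $H$: propositions are elements of $H$; connectives and quantifiers over $\mathbb N$ are the Heyting operations, countable joins and countable meets of $H$; $\mathsf{Brw}$ is the sheaf generated as above (with gluing), binary sequences are sections of the sheaf $\{0,1\}^{\mathbb N}$, and existence of a sequence or of an ordinal means local existence. The statement is that for every $P:\mathbb N\to H$, $$\bigwedge_n[\![P_n\text{ is semidecidable}]\!]\ \le\ [\![\exists n.\,P_n\text{ is }(\omega\cdot3)\text{-decidable}]\!],$$ and that over every $U\le\bigwedge_n[\![P_n\text{ is semidecidable}]\!]$ a section $y$ of $\mathsf{Brw}$ with $y=\Psi(P)$ exists, and every such $y$ satisfies $U\le[\![(\exists n.\,P_n)\leftrightarrow\omega\cdot 3\le y]\!]$. The case of ordinary truth values is $H=\{\bot,\top\}$. -/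

import Mathlib

/-!
Brouwer ordinals and ordinal decidability, in intuitionistic logic.

The notions below are constructive: in two-valued logic every proposition is decidable, and
"`P` is `α`-decidable" would hold for every `P` for an empty reason.  They are therefore
interpreted in the sheaf topos over an arbitrary frame `H` (for instance the open sets of a
topological space; ordinary two-valued logic is the case `H = Prop`).

* A proposition is a truth value `p : H`; `U ≤ p` means "`p` holds at stage `U`".  The
  connectives `∧, ∨, →, ↔` are the Heyting operations `⊓, ⊔, ⇨, ⇔` of `H`, the quantifiers over
  the natural numbers are `⨅` and `⨆`.
* A family of propositions `ℕ → Prop` is a map `ℕ → H`: the natural numbers object is the constant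
  sheaf, so a sequence of sections over `U` is an ordinary sequence of sections over `U`.
* `∃ x : X, φ x`, for a sheaf `X`, is the supremum of all stages `V` over which some section of
  `X` satisfies `φ` (local existence, i.e. the propositional truncation of the sum).
-/

namespace SheafBrw

open scoped symmDiff

universe u

/-- Raw codes for sections of the sheaf `Brw` of Brouwer ordinals: the point constructors
`zero`, `suc`, `lim`, and the amalgamation `glue D a` of the sections `a V` over `V`, `V ∈ D`. -/
inductive Code (H : Type u) : Type u
  | zero : Code H
  | suc : Code H → Code H
  | lim : (ℕ → Code H) → Code H
  | glue : Set H → (H → Code H) → Code H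

section

variable {H : Type u} [Order.Frame H]

mutual

/-- `IsBrw U a`: the code `a` denotes a section of `Brw` over `U`.  Limits are taken of strictly
increasing sequences only; amalgamations are taken of compatible families over a cover of `U`. -/
inductive IsBrw : H → Code H → Prop
  | zero (U : H) : IsBrw U Code.zero
  | suc {U : H} {a : Code H} : IsBrw U a → IsBrw U (Code.suc a)
  | lim {U : H} {f : ℕ → Code H} : (∀ n, IsBrw U (f n)) →
      (∀ n, Le U (Code.suc (f n)) (f (n + 1))) → IsBrw U (Code.lim f)
  | glue {U : H} {D : Set H} {a : H → Code H} : U ≤ sSup D →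
      (∀ V ∈ D, IsBrw (U ⊓ V) (a V)) →
      (∀ V ∈ D, ∀ W ∈ D, Le (U ⊓ V ⊓ W) (a V) (a W)) → IsBrw U (Code.glue D a)
  | cover {U : H} {a : Code H} (S : Set H) : U ≤ sSup S → (∀ V ∈ S, IsBrw V a) → IsBrw U a

/-- `Le U a b`: the relation `a ≤ b` of Brouwer ordinals holds at stage `U`.  It is generated by:
`zero` is least, `suc` is monotone, `lim f` is the least upper bound of the `f n`, transitivity,
`glue D a` agrees with `a V` over `V`, and truth is local.  Two sections are equal when each
is `≤` the other; so limits of bisimilar sequences are equal. -/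
inductive Le : H → Code H → Code H → Prop
  | zero_le {U : H} {a : Code H} : IsBrw U a → Le U Code.zero a
  | suc_mono {U : H} {a b : Code H} : Le U a b → Le U (Code.suc a) (Code.suc b)
  | le_lim {U : H} {a : Code H} {f : ℕ → Code H} (n : ℕ) :
      IsBrw U (Code.lim f) → Le U a (f n) → Le U a (Code.lim f)
  | lim_le {U : H} {b : Code H} {f : ℕ → Code H} :
      IsBrw U (Code.lim f) → (∀ n, Le U (f n) b) → Le U (Code.lim f) b
  | trans {U : H} {a b c : Code H} : Le U a b → Le U b c → Le U a c
  | glue_le {U V : H} {D : Set H} {a : H → Code H} : IsBrw U (Code.glue D a) → V ∈ D → U ≤ V →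
      Le U (Code.glue D a) (a V)
  | le_glue {U V : H} {D : Set H} {a : H → Code H} : IsBrw U (Code.glue D a) → V ∈ D → U ≤ V →
      Le U (a V) (Code.glue D a)
  | cover {U : H} {a b : Code H} (S : Set H) : U ≤ sSup S → (∀ V ∈ S, Le V a b) → Le U a b

end

/-- The truth value of `a ≤ b`. -/
def leVal (a b : Code H) : H := sSup {V | Le V a b}

theorem le_leVal_iff {U : H} {a b : Code H} : U ≤ leVal a b ↔ Le U a b :=
  ⟨fun h => Le.cover _ h fun _ hV => hV, fun h => le_sSup h⟩

/-- The truth value of `a = b`. -/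
def eqVal (a b : Code H) : H := leVal a b ⊓ leVal b a

end

section

variable {H : Type u}

/-- Addition of Brouwer ordinals, by recursion on the second argument. -/
def Code.add (a : Code H) : Code H → Code H
  | .zero => a
  | .suc b => .suc (Code.add a b)
  | .lim f => .lim fun n => Code.add a (f n)
  | .glue D b => .glue D fun V => Code.add a (b V)

/-- The finite ordinals. -/
def Code.ofNat : ℕ → Code H
  | 0 => .zero
  | n + 1 => .suc (Code.ofNat n)

/-- The ordinal `ω`, the limit of the finite ordinals. -/
def Code.omega : Code H := .lim Code.ofNat

/-- The product `a · n`, for a finite ordinal `n`: `a · 0 = 0` and `a · (n + 1) = a · n + a`. -/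
def Code.mulNat (a : Code H) : ℕ → Code H
  | 0 => .zero
  | n + 1 => Code.add (Code.mulNat a n) a

end

section

variable {H : Type u} [Order.Frame H]

/-- The truth value of "`p` is `α`-decidable", i.e. of `∃ y : Brw, (p ↔ α ≤ y)`. -/
def ordDec (α : Code H) (p : H) : H :=
  sSup {V | ∃ y : Code H, IsBrw V y ∧ V ≤ p ⇔ leVal α y}

/-- `IsSemiDecData V s p`: over `V`, `s` is a binary sequence with `p ↔ ∃ i, s i = 1`.  A section of
`ℕ → 2` over `V` is given by the truth values `s i` of `s i = 1`, which are decidable over `V`. -/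
def IsSemiDecData (V : H) (s : ℕ → H) (p : H) : Prop :=
  (∀ i, V ≤ s i ⊔ (s i)ᶜ) ∧ V ≤ p ⇔ ⨆ i, s i

/-- The truth value of "`p` is semidecidable", i.e. of `∃ s : ℕ → 2, (p ↔ ∃ i, s i = 1)`. -/
def semiDec (p : H) : H := sSup {V | ∃ s : ℕ → H, IsSemiDecData V s p}

/-- The increasing binary sequence `t` with `t 0 = s 0` and `t (k + 1) = t k ∨ s (k + 1)`. -/
def upSeq (s : ℕ → H) : ℕ → H
  | 0 => s 0
  | k + 1 => upSeq s k ⊔ s (k + 1)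

/-- The truth value of "exactly `m` of the `n` bits `upSeq (s i) k`, `i < n`, are `1`", i.e. of
`t k = m` for the pointwise sum `t` of the sequences `upSeq (s i)`, `i < n`. -/
def countVal (n : ℕ) (s : ℕ → ℕ → H) (k m : ℕ) : H :=
  ⨆ A ∈ (Finset.range n).powersetCard m,
    (⨅ i ∈ A, upSeq (s i) k) ⊓ ⨅ i ∈ Finset.range n \ A, (upSeq (s i) k)ᶜ

/-- Over `V`, `z` is the limit of the sequence `k ↦ ω · t k + k`, where `t k` is the number of
bits `upSeq (s i) k`, `i < n`, that are `1`. -/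
def IsApproxOfData (V : H) (n : ℕ) (s : ℕ → ℕ → H) (z : Code H) : Prop :=
  ∃ g : ℕ → Code H, IsBrw V (Code.lim g) ∧
    (∀ k m, V ⊓ countVal n s k m ≤
      eqVal (g k) (Code.add (Code.mulNat Code.omega m) (Code.ofNat k))) ∧
    V ≤ eqVal z (Code.lim g)

/-- The truth value of `z = Ψₙ(P)`: for some semidecidability data of `P i`, `i < n`, the ordinal `z`
is the one given by these data (which does not depend on them). -/
def approxVal (P : ℕ → H) (n : ℕ) (z : Code H) : H :=
  sSup {V | ∃ s : ℕ → ℕ → H, (∀ i < n, IsSemiDecData V (s i) (P i)) ∧ IsApproxOfData V n s z}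

/-- Over `U`, `y` is the characteristic ordinal `Ψ(P)`, the limit of `n ↦ Ψₙ(P) + n`. -/
def IsCharOrd (U : H) (P : ℕ → H) (y : Code H) : Prop :=
  ∃ z : ℕ → Code H, (∀ n, U ≤ approxVal P n (z n)) ∧
    IsBrw U (Code.lim fun n => Code.add (z n) (Code.ofNat n)) ∧
    U ≤ eqVal y (Code.lim fun n => Code.add (z n) (Code.ofNat n))

end

end SheafBrw

namespace SheafBrw

open scoped symmDiff

universe u

-- If `P i` holds, then for `n > i` the counts `t k` are eventually positive, so `Ψₙ` lies above the
-- limit `ω · 2` of the `ω + k`, and `Ψ` above the limit `ω · 3` of the `ω · 2 + n`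
-- (`approxVal_inf_le_leVal`). Conversely, `ω · 3 ≤ Ψ` gives `ω · 2 + 1 ≤ Ψₙ + n` for some `n`.
-- Since `ω · 2` has the form `a + ω`, the finite summand can be dropped: `ω · 2 ≤ Ψₙ`. Hence `ω + 1
-- ≤ ω · t k + k` for some `k`. The count is decidable, and `t k = 0` would give `ω ≤ k`; so some
-- bit is `1` and some `P i` holds (`approxVal_inf_leSem_le`).
--
-- The converse inverts `≤`, which the transitivity rule obstructs. It uses instead a relation
-- `leSem` computed by recursion on codes, in which a successor below a limit is below a term;
-- `Le.le_leSem` shows that it satisfies every generating rule.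
--
-- Existence of `Ψ` needs no countable choice: `Ψₙ` uses finitely many semideciding sequences, which
-- exist locally together, and it does not depend on them (`IsApproxOfData.le`), so the local
-- ordinals glue.

theorem zero_add_ofNat {H : Type u} (k : ℕ) : Code.add (.zero : Code H) (.ofNat k) = .ofNat k := by
  induction k with
  | zero => rfl
  | succ k ih => exact congrArg Code.suc ih

theorem add_ofNat_add_ofNat {H : Type u} (a : Code H) (k l : ℕ) :
    (a.add (.ofNat k)).add (.ofNat l) = a.add (.ofNat (k + l)) := by
  induction l with
  | zero => rfl
  | succ l ih => exact congrArg Code.suc ih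

-- Reflexivity, restriction and gluing

section Order

variable {H : Type u} [Order.Frame H]

theorem IsBrw.mono {U V : H} {a : Code H} (h : IsBrw U a) (hV : V ≤ U) : IsBrw V a :=
  .cover {U} (by simpa using hV) (by simpa using h)

theorem Le.mono {U V : H} {a b : Code H} (h : Le U a b) (hV : V ≤ U) : Le V a b :=
  .cover {U} (by simpa using hV) (by simpa using h)

theorem le_eqVal_iff {U : H} {a b : Code H} : U ≤ eqVal a b ↔ Le U a b ∧ Le U b a := by
  rw [eqVal, le_inf_iff, le_leVal_iff, le_leVal_iff]

/-- Reflexivity is not among the generating rules; it follows by induction on the formation of the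
code, and the bound by the successor uses it at limits and amalgamations. -/
theorem IsBrw.le_refl_and_le_suc {U : H} {a : Code H} (h : IsBrw U a) :
    Le U a a ∧ Le U a (.suc a) := by
  refine IsBrw.rec (motive_1 := fun U a _ => Le U a a ∧ Le U a (.suc a))
    (motive_2 := fun _ _ _ _ => True) ?_ ?_ ?_ ?_ ?_ ?_ ?_ ?_ ?_ ?_ ?_ ?_ ?_ h
  · exact fun U => ⟨.zero_le (.zero U), .zero_le (.suc (.zero U))⟩
  · exact fun _ ih => ⟨.suc_mono ih.1, .suc_mono ih.2⟩
  · intro U f hf hs ih _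
    have hl := IsBrw.lim hf hs
    exact ⟨.lim_le hl fun n => .le_lim n hl (ih n).1,
      .lim_le hl fun n => (ih n).2.trans (.suc_mono (.le_lim n hl (ih n).1))⟩
  · intro U D a hD hb hc ih _
    have hg := IsBrw.glue hD hb hc
    have hcov : U ≤ sSup ((U ⊓ ·) '' D) := by
      rw [sSup_image, ← inf_sSup_eq]
      exact le_inf le_rfl hD
    constructor
    · refine .cover _ hcov ?_
      rintro _ ⟨V, hV, rfl⟩
      have hg' := hg.mono (inf_le_left : U ⊓ V ≤ U)
      exact (Le.glue_le hg' hV inf_le_right).trans (.le_glue hg' hV inf_le_right)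
    · refine .cover _ hcov ?_
      rintro _ ⟨V, hV, rfl⟩
      have hg' := hg.mono (inf_le_left : U ⊓ V ≤ U)
      exact (Le.glue_le hg' hV inf_le_right).trans
        ((ih V hV).2.trans (.suc_mono (.le_glue hg' hV inf_le_right)))
  · exact fun S hS _ ih => ⟨.cover S hS fun V hV => (ih V hV).1, .cover S hS fun V hV => (ih V hV).2⟩
  all_goals intros; trivial

theorem IsBrw.le_refl {U : H} {a : Code H} (h : IsBrw U a) : Le U a a :=
  h.le_refl_and_le_suc.1

theorem IsBrw.le_suc {U : H} {a : Code H} (h : IsBrw U a) : Le U a (.suc a) :=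
  h.le_refl_and_le_suc.2

theorem le_lim_self {U : H} {f : ℕ → Code H} (hf : IsBrw U (.lim f)) {n : ℕ}
    (hn : IsBrw U (f n)) : Le U (f n) (.lim f) :=
  .le_lim n hf hn.le_refl

/-- Compatible local sections over a cover of `U` have an amalgamation over `U`. -/
theorem exists_amalgamation {ι : Type*} {U : H} (V : ι → H) (c : ι → Code H)
    (hU : U ≤ ⨆ i, V i) (hc : ∀ i, IsBrw (U ⊓ V i) (c i))
    (hcc : ∀ i j, Le (U ⊓ V i ⊓ V j) (c i) (c j)) :
    ∃ z, IsBrw U z ∧ ∀ i, U ⊓ V i ≤ eqVal z (c i) := by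
  classical
  -- `glue` indexes its components by stages, so one index is picked for each value of `V`; by `hcc`
  -- another index with the same stage gives an equal section.
  let pick : H → Code H := fun W => if h : ∃ i, V i = W then c h.choose else .zero
  have hpick : ∀ i, ∃ j, V j = V i ∧ pick (V i) = c j := fun i => by
    have h : ∃ j, V j = V i := ⟨i, rfl⟩
    exact ⟨h.choose, h.choose_spec, dif_pos h⟩
  have hz : IsBrw U (.glue (Set.range V) pick) := by
    refine .glue (by rwa [sSup_range]) ?_ ?_
    · rintro _ ⟨i, rfl⟩
      obtain ⟨j, hj, hp⟩ := hpick i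
      rw [hp, ← hj]
      exact hc j
    · rintro _ ⟨i, rfl⟩ _ ⟨i', rfl⟩
      obtain ⟨j, hj, hp⟩ := hpick i
      obtain ⟨j', hj', hp'⟩ := hpick i'
      rw [hp, hp', ← hj, ← hj']
      exact hcc j j'
  refine ⟨_, hz, fun i => ?_⟩
  obtain ⟨j, hj, hp⟩ := hpick i
  have hz' := hz.mono (inf_le_left : U ⊓ V i ≤ U)
  have h₁ := Le.glue_le hz' ⟨i, rfl⟩ inf_le_right
  have h₂ := Le.le_glue hz' ⟨i, rfl⟩ inf_le_right
  rw [hp] at h₁ h₂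
  rw [le_eqVal_iff]
  refine ⟨h₁.trans ((hcc j i).mono ?_), ((hcc i j).mono ?_).trans h₂⟩ <;> rw [hj] <;> simp

end Order

-- The ordinals `ω · m + k`

section Arithmetic

variable {H : Type u} [Order.Frame H]

theorem IsBrw.add_ofNat {U : H} {a : Code H} (h : IsBrw U a) (n : ℕ) :
    IsBrw U (a.add (.ofNat n)) := by
  induction n with
  | zero => exact h
  | succ n ih => exact .suc ih

theorem Le.add_ofNat {U : H} {a b : Code H} (h : Le U a b) (n : ℕ) :
    Le U (a.add (.ofNat n)) (b.add (.ofNat n)) := by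
  induction n with
  | zero => exact h
  | succ n ih => exact .suc_mono ih

theorem IsBrw.add_ofNat_le {U : H} {a : Code H} (h : IsBrw U a) {m n : ℕ} (hmn : m ≤ n) :
    Le U (a.add (.ofNat m)) (a.add (.ofNat n)) := by
  induction n, hmn using Nat.le_induction with
  | base => exact (h.add_ofNat m).le_refl
  | succ n _ ih => exact ih.trans (h.add_ofNat n).le_suc

theorem IsBrw.add_omega {U : H} {a : Code H} (h : IsBrw U a) : IsBrw U (a.add .omega) :=
  .lim h.add_ofNat fun n => (h.add_ofNat (n + 1)).le_refl

theorem IsBrw.mulNat_omega (U : H) (m : ℕ) : IsBrw U (Code.mulNat .omega m) := by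
  induction m with
  | zero => exact .zero U
  | succ m ih => exact ih.add_omega

theorem mulNat_omega_le (U : H) {m n : ℕ} (hmn : m ≤ n) :
    Le U (Code.mulNat .omega m) (Code.mulNat .omega n) := by
  induction n, hmn using Nat.le_induction with
  | base => exact (IsBrw.mulNat_omega U m).le_refl
  | succ n _ ih =>
    have h := IsBrw.mulNat_omega U n
    exact ih.trans (le_lim_self (n := 0) h.add_omega h)

theorem mulNat_omega_add_ofNat_le (U : H) {m n k l : ℕ} (hmn : m ≤ n) (hkl : k ≤ l) :
    Le U ((Code.mulNat .omega m).add (.ofNat k)) ((Code.mulNat .omega n).add (.ofNat l)) :=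
  ((mulNat_omega_le U hmn).add_ofNat k).trans ((IsBrw.mulNat_omega U n).add_ofNat_le hkl)

end Arithmetic

-- A recursive model of the order, for inversion

section Semantics

variable {H : Type u} [Order.Frame H]

/-- The truth value of `a < b`, by recursion on `b`, where `p` is the truth value of `a ≤ ·`. -/
def Code.ltSem (p : Code H → H) : Code H → H
  | .zero => ⊥
  | .suc b => p b
  | .lim f => ⨆ n, Code.ltSem p (f n)
  | .glue D b => ⨆ V ∈ D, V ⊓ Code.ltSem p (b V)

/-- A truth value of `a ≤ b` computed by recursion, from which the order can be inverted. -/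
def Code.leSem : Code H → Code H → H
  | .zero => fun _ => ⊤
  | .suc a => Code.ltSem (Code.leSem a)
  | .lim f => fun b => ⨅ n, Code.leSem (f n) b
  | .glue D a => fun b => ⨅ V ∈ D, V ⇨ Code.leSem (a V) b

/-- The truth value of the compatibility of the components of an amalgamation. -/
def Code.compatSem : Code H → H
  | .glue D a => ⨅ V ∈ D, ⨅ W ∈ D, V ⊓ W ⇨ Code.leSem (a V) (a W)
  | _ => ⊤

theorem leSem_le_leSem_lim (a : Code H) (f : ℕ → Code H) (n : ℕ) :
    a.leSem (f n) ≤ a.leSem (.lim f) := by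
  induction a with
  | zero => exact le_rfl
  | suc a _ => exact le_iSup (fun n => Code.ltSem a.leSem (f n)) n
  | lim g ih => exact iInf_mono ih
  | glue D b ih => exact iInf₂_mono fun V _ => himp_le_himp_left (ih V)

theorem inf_leSem_le_leSem_glue (a : Code H) {D : Set H} (b : H → Code H) {V : H} (hV : V ∈ D) :
    V ⊓ a.leSem (b V) ≤ a.leSem (.glue D b) := by
  induction a with
  | zero => exact le_top
  | suc a _ => exact le_iSup₂ (f := fun V (_ : V ∈ D) => V ⊓ Code.ltSem a.leSem (b V)) V hV
  | lim g ih => exact le_iInf fun n => (inf_le_inf_left V (iInf_le _ n)).trans (ih n)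
  | glue E c ih =>
    refine le_iInf₂ fun W hW => ?_
    rw [le_himp_iff]
    refine le_trans (le_inf (inf_le_left.trans inf_le_left) ?_) (ih W)
    exact (inf_le_inf_right W (inf_le_right.trans (iInf₂_le W hW))).trans himp_inf_le

theorem leSem_refl (a : Code H) : a.leSem a = ⊤ := by
  rw [eq_top_iff]
  induction a with
  | zero => exact le_rfl
  | suc a ih => exact ih
  | lim f ih => exact le_iInf fun n => (ih n).trans (leSem_le_leSem_lim _ f n)
  | glue D b ih =>
    refine le_iInf₂ fun V hV => ?_
    rw [le_himp_iff, top_inf_eq]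
    exact (le_inf le_rfl (le_top.trans (ih V))).trans (inf_leSem_le_leSem_glue _ b hV)

/-- Outer induction on the left code. For a successor on the left, the middle code is followed down
to a successor, then the right code is too; there both outer successors cancel. -/
theorem leSem_trans (a b c : Code H) : a.leSem b ⊓ b.leSem c ≤ a.leSem c := by
  induction a generalizing b c with
  | zero => exact le_top
  | suc a iha =>
    induction b generalizing c with
    | zero => exact inf_le_left.trans bot_le
    | suc b _ =>
      induction c with
      | zero => exact inf_le_right.trans bot_le
      | suc c _ => exact iha b c
      | lim f ih => exact (inf_iSup_eq _ _).trans_le (iSup_mono ih)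
      | glue D d ih =>
        refine (inf_iSup₂_eq _).trans_le (iSup₂_mono fun V _ => ?_)
        rw [inf_left_comm]
        exact inf_le_inf_left V (ih V)
    | lim f ih =>
      refine (iSup_inf_eq _ _).trans_le (iSup_le fun n => ?_)
      exact (inf_le_inf_left _ (iInf_le _ n)).trans (ih n c)
    | glue D d ih =>
      refine (iSup₂_inf_eq _).trans_le (iSup₂_le fun V hV => ?_)
      refine le_trans (le_inf (inf_le_left.trans inf_le_right) ?_) (ih V c)
      exact (le_inf (inf_le_right.trans (iInf₂_le V hV)) (inf_le_left.trans inf_le_left)).trans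
        himp_inf_le
  | lim f ih => exact le_iInf fun n => (inf_le_inf_right _ (iInf_le _ n)).trans (ih n b c)
  | glue D d ih =>
    refine le_iInf₂ fun V hV => ?_
    rw [le_himp_iff]
    refine le_trans (le_inf ?_ (inf_le_left.trans inf_le_right)) (ih V b c)
    exact (inf_le_inf_right V (inf_le_left.trans (iInf₂_le V hV))).trans himp_inf_le

/-- The recursive truth values are a model of the rules that generate `≤`. -/
theorem Le.le_leSem {U : H} {a b : Code H} (h : Le U a b) : U ≤ a.leSem b := by
  -- The rule `glue_le` is sound only for compatible components, so compatibility is carried along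
  -- as the invariant of `IsBrw`.
  refine Le.rec (motive_1 := fun U a _ => U ≤ a.compatSem) (motive_2 := fun U a b _ => U ≤ a.leSem b)
    ?_ ?_ ?_ ?_ ?_ ?_ ?_ ?_ ?_ ?_ ?_ ?_ ?_ h
  · exact fun _ => le_top
  · exact fun _ _ => le_top
  · exact fun _ _ _ _ => le_top
  · intro U D a _ _ _ _ ih
    refine le_iInf₂ fun V hV => le_iInf₂ fun W hW => ?_
    rw [le_himp_iff, ← inf_assoc]
    exact ih V hV W hW
  · exact fun S hS _ ih => hS.trans (sSup_le ih)
  · exact fun _ _ => le_top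
  · exact fun _ ih => ih
  · exact fun n _ _ _ ih => ih.trans (leSem_le_leSem_lim _ _ n)
  · exact fun _ _ _ ih => le_iInf ih
  · exact fun _ _ h₁ h₂ => (le_inf h₁ h₂).trans (leSem_trans _ _ _)
  · intro U V D a _ hV hUV hc
    refine le_iInf₂ fun W hW => ?_
    rw [le_himp_iff]
    have h₁ : U ≤ W ⊓ V ⇨ (a W).leSem (a V) :=
      hc.trans ((iInf₂_le W hW).trans (iInf₂_le V hV))
    exact (le_inf (inf_le_left.trans h₁) (le_inf inf_le_right (inf_le_left.trans hUV))).trans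
      himp_inf_le
  · intro U V D a _ hV hUV _
    exact (le_inf hUV ((leSem_refl (a V)).symm ▸ le_top)).trans (inf_leSem_le_leSem_glue _ a hV)
  · exact fun S hS _ ih => hS.trans (sSup_le ih)

theorem leVal_le_leSem (a b : Code H) : leVal a b ≤ a.leSem b :=
  (le_leVal_iff.1 le_rfl).le_leSem

/-- Transitivity through `a ≤ suc a`, which the model satisfies for all codes, well formed or not.
-/
theorem leSem_suc_le (a b : Code H) : (Code.suc a).leSem b ≤ a.leSem b := by
  have key : ∀ a : Code H, a.leSem (.suc a) = ⊤ := by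
    intro a
    rw [eq_top_iff]
    induction a with
    | zero => exact le_rfl
    | suc a ih => exact ih
    | lim f ih =>
      refine le_iInf fun n => (le_inf (ih n) ?_).trans (leSem_trans _ (.suc (f n)) _)
      exact ((leSem_refl (f n)).symm.le).trans (leSem_le_leSem_lim _ f n)
    | glue D c ih =>
      refine le_iInf₂ fun V hV => ?_
      rw [le_himp_iff, top_inf_eq]
      refine (le_inf (le_top.trans (ih V)) ?_).trans (leSem_trans _ (.suc (c V)) _)
      exact (le_inf le_rfl (le_top.trans (leSem_refl (c V)).symm.le)).trans
        (inf_leSem_le_leSem_glue (c V) c hV)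
  exact (le_inf (le_top.trans (key a).symm.le) le_rfl).trans (leSem_trans _ (.suc a) _)

/-- A limit of the form `a + ω` is below `b` as soon as it is below `b + n`. -/
theorem leSem_add_omega_add_ofNat_le (a b : Code H) (n : ℕ) :
    (a.add .omega).leSem (b.add (.ofNat n)) ≤ (a.add .omega).leSem b := by
  induction n with
  | zero => exact le_rfl
  | succ n ih =>
    refine le_trans (le_iInf fun k => ?_) ih
    -- Instance `k + 1` of the hypothesis has successors on both sides, and `leSem` cancels them by
    -- definition.
    exact iInf_le (fun k => (a.add (.ofNat k)).leSem (b.add (.ofNat (n + 1)))) (k + 1)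

theorem leSem_add_omega_le (a b : Code H) (k : ℕ) :
    (a.add .omega).leSem b ≤ (a.add (.ofNat k)).leSem b :=
  iInf_le (fun k => (a.add (.ofNat k)).leSem b) k

theorem leSem_omega_ofNat (k : ℕ) : (Code.omega : Code H).leSem (.ofNat k) = ⊥ := by
  have key : ∀ k, (Code.ofNat (k + 1) : Code H).leSem (.ofNat k) = ⊥ := by
    intro k
    induction k with
    | zero => rfl
    | succ k ih => exact ih
  exact le_bot_iff.1 ((iInf_le (fun j => (Code.ofNat j : Code H).leSem (.ofNat k)) (k + 1)).trans
    (key k).le)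

end Semantics

-- Counting decidable bits

section Counting

variable {H : Type u} [Order.Frame H]

theorem upSeq_mono (s : ℕ → H) : Monotone (upSeq s) :=
  monotone_nat_of_le_succ fun _ => le_sup_left

theorem le_upSeq (s : ℕ → H) (k : ℕ) : s k ≤ upSeq s k := by
  cases k with
  | zero => exact le_rfl
  | succ k => exact le_sup_right

theorem upSeq_le_iSup (s : ℕ → H) (k : ℕ) : upSeq s k ≤ ⨆ j, s j := by
  induction k with
  | zero => exact le_iSup s 0
  | succ k ih => exact sup_le ih (le_iSup s (k + 1))

theorem le_upSeq_sup_compl {V : H} {s : ℕ → H} (hs : ∀ i, V ≤ s i ⊔ (s i)ᶜ) (k : ℕ) :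
    V ≤ upSeq s k ⊔ (upSeq s k)ᶜ := by
  induction k with
  | zero => exact hs 0
  | succ k ih =>
    refine (le_inf ih (hs (k + 1))).trans ?_
    rw [upSeq, compl_sup, sup_inf_left]
    exact le_inf (inf_le_left.trans (sup_le_sup_right le_sup_left _))
      (inf_le_right.trans (sup_le_sup_right le_sup_right _))

/-- Deciding the bits one at a time locates the set `A` of those that are `1`. -/
theorem le_iSup_powerset {V : H} (I : Finset ℕ) (u : ℕ → H) (hu : ∀ i ∈ I, V ≤ u i ⊔ (u i)ᶜ) :
    V ≤ ⨆ A ∈ I.powerset, (⨅ i ∈ A, u i) ⊓ ⨅ i ∈ I \ A, (u i)ᶜ := by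
  induction I using Finset.induction_on with
  | empty => simp
  | insert a I ha ih =>
    refine (le_inf (ih fun i hi => hu i (Finset.mem_insert_of_mem hi))
      (hu a (Finset.mem_insert_self a I))).trans ?_
    rw [iSup₂_inf_eq]
    refine iSup₂_le fun A hA => ?_
    have hAI := Finset.mem_powerset.1 hA
    rw [inf_sup_left]
    refine sup_le ?_ ?_
    · refine le_trans ?_ (le_iSup₂ (insert a A)
        (Finset.mem_powerset.2 (Finset.insert_subset_insert a hAI)))
      refine le_inf (le_iInf₂ fun i hi => ?_) (le_iInf₂ fun i hi => ?_)
      · rcases Finset.mem_insert.1 hi with rfl | hi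
        · exact inf_le_right
        · exact inf_le_left.trans (inf_le_left.trans (iInf₂_le i hi))
      · refine inf_le_left.trans (inf_le_right.trans (iInf₂_le i ?_))
        simp only [Finset.mem_sdiff, Finset.mem_insert] at hi ⊢
        tauto
    · refine le_trans ?_ (le_iSup₂ A
        (Finset.mem_powerset.2 (hAI.trans (Finset.subset_insert a I))))
      refine le_inf (inf_le_left.trans inf_le_left) (le_iInf₂ fun i hi => ?_)
      rcases eq_or_ne i a with rfl | hia
      · exact inf_le_right
      · refine inf_le_left.trans (inf_le_right.trans (iInf₂_le i ?_))
        simp only [Finset.mem_sdiff, Finset.mem_insert] at hi ⊢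
        tauto

/-- Decidable bits can be counted. -/
theorem le_iSup_countVal {V : H} {n : ℕ} {s : ℕ → ℕ → H}
    (hs : ∀ i < n, ∀ j, V ≤ s i j ⊔ (s i j)ᶜ) (k : ℕ) : V ≤ ⨆ m, countVal n s k m := by
  refine (le_iSup_powerset (Finset.range n) (fun i => upSeq (s i) k)
    fun i hi => le_upSeq_sup_compl (hs i (Finset.mem_range.1 hi)) k).trans ?_
  refine iSup₂_le fun A hA => le_trans ?_ (le_iSup _ A.card)
  exact le_iSup₂ (f := fun A (_ : A ∈ (Finset.range n).powersetCard _) =>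
    (⨅ i ∈ A, upSeq (s i) k) ⊓ ⨅ i ∈ Finset.range n \ A, (upSeq (s i) k)ᶜ) A
    (Finset.mem_powersetCard.2 ⟨Finset.mem_powerset.1 hA, rfl⟩)

/-- Pigeonhole: when the count drops, some bit in the larger set is missing from the smaller one,
hence both `1` and `0`. -/
theorem inf_countVal_inf_countVal_eq_bot {W : H} {n n' : ℕ} {s s' : ℕ → ℕ → H} {k k' m m' : ℕ}
    (hn : n ≤ n') (hu : ∀ i < n, W ⊓ upSeq (s i) k ≤ upSeq (s' i) k') (hm : m' < m) :
    W ⊓ countVal n s k m ⊓ countVal n' s' k' m' = ⊥ := by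
  rw [← le_bot_iff]
  simp only [countVal, inf_iSup_eq, iSup_inf_eq]
  refine iSup₂_le fun B hB => iSup₂_le fun A hA => ?_
  rw [Finset.mem_powersetCard] at hA hB
  obtain ⟨i, hiA, hiB⟩ : ∃ i ∈ A, i ∉ B := by
    by_contra! h
    exact absurd (Finset.card_le_card h) (by omega)
  have hin : i < n := Finset.mem_range.1 (hA.1 hiA)
  have hin' : i ∈ Finset.range n' \ B :=
    Finset.mem_sdiff.2 ⟨Finset.mem_range.2 (hin.trans_le hn), hiB⟩
  refine le_trans (le_inf ?_ ?_) (inf_compl_self (upSeq (s' i) k')).le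
  · exact (inf_le_left.trans (inf_le_inf_left W (inf_le_left.trans (iInf₂_le i hiA)))).trans
      (hu i hin)
  · exact inf_le_right.trans (inf_le_right.trans (iInf₂_le i hin'))

theorem countVal_zero_le {n : ℕ} (s : ℕ → ℕ → H) (k : ℕ) {i : ℕ} (hi : i < n) :
    countVal n s k 0 ≤ (upSeq (s i) k)ᶜ := by
  refine iSup₂_le fun A hA => inf_le_right.trans (iInf₂_le i ?_)
  rw [Finset.mem_powersetCard, Finset.card_eq_zero] at hA
  simpa [hA.2] using hi

theorem countVal_le_iSup {n : ℕ} (s : ℕ → ℕ → H) (k : ℕ) {m : ℕ} (hm : m ≠ 0) :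
    countVal n s k m ≤ ⨆ i ∈ Finset.range n, upSeq (s i) k := by
  refine iSup₂_le fun A hA => ?_
  rw [Finset.mem_powersetCard] at hA
  obtain ⟨i, hi⟩ := Finset.card_ne_zero.1 (hA.2.trans_ne hm)
  exact inf_le_left.trans ((iInf₂_le i hi).trans
    (le_iSup₂ (f := fun i (_ : i ∈ Finset.range n) => upSeq (s i) k) i (hA.1 hi)))

theorem le_of_inf_countVal_le {W : H} {n : ℕ} {s : ℕ → ℕ → H} {k : ℕ}
    (hW : W ≤ ⨆ m, countVal n s k m) {c : H} (h : ∀ m, W ⊓ countVal n s k m ≤ c) : W ≤ c := by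
  refine (le_inf le_rfl hW).trans ?_
  rw [inf_iSup_eq]
  exact iSup_le h

/-- Sections that are `ω · t + k` and `ω · t' + k'` are ordered when the counts `t`, `t'` are. -/
theorem le_of_countVal {W : H} {n n' : ℕ} {s s' : ℕ → ℕ → H} {k k' j : ℕ} {a b : Code H}
    (hn : n ≤ n') (hu : ∀ i < n, W ⊓ upSeq (s i) k ≤ upSeq (s' i) k') (hk : k + j ≤ k')
    (hW : W ≤ ⨆ m, countVal n s k m) (hW' : W ≤ ⨆ m, countVal n' s' k' m)
    (ha : ∀ m, W ⊓ countVal n s k m ≤ eqVal a (.add (.mulNat .omega m) (.ofNat k)))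
    (hb : ∀ m, W ⊓ countVal n' s' k' m ≤ eqVal b (.add (.mulNat .omega m) (.ofNat k'))) :
    Le W (a.add (.ofNat j)) b := by
  rw [← le_leVal_iff]
  refine le_of_inf_countVal_le hW fun m => ?_
  refine le_of_inf_countVal_le (inf_le_left.trans hW') fun m' => ?_
  rcases le_or_gt m m' with hm | hm
  · rw [le_leVal_iff]
    have h₁ := (le_eqVal_iff.1 (ha m)).1.mono
      (inf_le_left : W ⊓ countVal n s k m ⊓ countVal n' s' k' m' ≤ _)
    have h₂ := (le_eqVal_iff.1 (hb m')).2.mono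
      (inf_le_inf_right _ inf_le_left : W ⊓ countVal n s k m ⊓ countVal n' s' k' m' ≤ _)
    have h₃ := h₁.add_ofNat j
    rw [add_ofNat_add_ofNat] at h₃
    exact h₃.trans ((mulNat_omega_add_ofNat_le _ hm hk).trans h₂)
  · rw [inf_countVal_inf_countVal_eq_bot hn hu hm]
    exact bot_le

end Counting

-- The approximations `Ψₙ` and the characteristic ordinal

section Approximation

variable {H : Type u} [Order.Frame H]

theorem IsSemiDecData.mono {V W : H} {s : ℕ → H} {p : H} (h : IsSemiDecData V s p) (hW : W ≤ V) :
    IsSemiDecData W s p :=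
  ⟨fun i => hW.trans (h.1 i), hW.trans h.2⟩

theorem IsSemiDecData.inf_le_iSup {V : H} {s : ℕ → H} {p : H} (h : IsSemiDecData V s p) :
    V ⊓ p ≤ ⨆ i, s i :=
  inf_comm V p ▸ (le_bihimp_iff.1 h.2).2

theorem IsSemiDecData.inf_upSeq_le {V : H} {s : ℕ → H} {p : H} (h : IsSemiDecData V s p) (k : ℕ) :
    V ⊓ upSeq s k ≤ p :=
  (inf_le_inf_left V (upSeq_le_iSup s k)).trans (inf_comm V _ ▸ (le_bihimp_iff.1 h.2).1)

theorem IsApproxOfData.congr {V W : H} {n : ℕ} {s : ℕ → ℕ → H} {z w : Code H}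
    (h : IsApproxOfData V n s z) (hW : W ≤ V) (hzw : W ≤ eqVal w z) : IsApproxOfData W n s w := by
  obtain ⟨g, hg, hc, hz⟩ := h
  refine ⟨g, hg.mono hW, fun k m => (inf_le_inf_right _ hW).trans (hc k m), ?_⟩
  have h₁ := le_eqVal_iff.1 (hW.trans hz)
  have h₂ := le_eqVal_iff.1 hzw
  exact le_eqVal_iff.2 ⟨h₂.1.trans h₁.1, h₁.2.trans h₂.2⟩

/-- Finitely many bits that are `1` by stage `k` of one family of semidecidability data are `1` by
some common stage of any other. -/
theorem le_iSup_iInf_himp {V : H} {P : ℕ → H} {n : ℕ} {s s' : ℕ → ℕ → H}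
    (hs : ∀ i < n, IsSemiDecData V (s i) (P i)) (hs' : ∀ i < n, IsSemiDecData V (s' i) (P i))
    (k : ℕ) : V ≤ ⨆ l, ⨅ i : Fin n, upSeq (s i) k ⇨ upSeq (s' i) l := by
  -- A finite meet commutes with an increasing join, so each bit may be treated alone. If it is `1`,
  -- then `P i` holds and `s' i` reaches a `1`; if it is `0`, any `l` works.
  rw [iSup_iInf_of_monotone fun i _ _ h => himp_le_himp_left (upSeq_mono _ h)]
  refine le_iInf fun i => ?_
  refine (le_inf le_rfl (le_upSeq_sup_compl (hs i i.2).1 k)).trans ?_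
  rw [inf_sup_left]
  refine sup_le ?_ ?_
  · refine (le_inf inf_le_left ((hs i i.2).inf_upSeq_le k)).trans
      ((hs' i i.2).inf_le_iSup.trans (iSup_mono fun l => ?_))
    exact (le_upSeq _ l).trans le_himp
  · refine inf_le_right.trans (le_trans ?_ (le_iSup _ 0))
    exact compl_le_himp

/-- The approximations of the characteristic ordinal do not depend on the data, and increase. -/
theorem IsApproxOfData.le {V : H} {P : ℕ → H} {n n' : ℕ} {s s' : ℕ → ℕ → H} {z z' : Code H}
    (hn : n ≤ n') (hs : ∀ i < n, IsSemiDecData V (s i) (P i))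
    (hs' : ∀ i < n', IsSemiDecData V (s' i) (P i))
    (h : IsApproxOfData V n s z) (h' : IsApproxOfData V n' s' z') : Le V z z' := by
  obtain ⟨g, hg, hc, hz⟩ := h
  obtain ⟨g', hg', hc', hz'⟩ := h'
  refine (le_eqVal_iff.1 hz).1.trans (.trans (.lim_le hg fun k => ?_) (le_eqVal_iff.1 hz').2)
  rw [← le_leVal_iff]
  refine (le_inf le_rfl (le_iSup_iInf_himp hs (fun i hi => hs' i (hi.trans_le hn)) k)).trans ?_
  rw [inf_iSup_eq]
  refine iSup_le fun l => le_leVal_iff.2 (.le_lim (max k l) (hg'.mono inf_le_left) ?_)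
  have hW : V ⊓ ⨅ i : Fin n, upSeq (s i) k ⇨ upSeq (s' i) l ≤ V := inf_le_left
  refine le_of_countVal (j := 0) hn (fun i hi => ?_) (le_max_left k l)
    (hW.trans (le_iSup_countVal (fun i hi => (hs i hi).1) k))
    (hW.trans (le_iSup_countVal (fun i hi => (hs' i hi).1) _))
    (fun m => (inf_le_inf_right _ hW).trans (hc k m))
    fun m => (inf_le_inf_right _ hW).trans (hc' _ m)
  refine le_trans ?_ (upSeq_mono _ (le_max_right k l))
  exact (inf_le_inf_right _ (inf_le_right.trans (iInf_le _ (⟨i, hi⟩ : Fin n)))).trans himp_inf_le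

/-- Each term is glued from the ordinals `ω · m + k` over the stages where the count is `m`. Counts
never drop with `k`, and the summand `k` makes the sequence strictly increasing. -/
theorem exists_isApproxOfData {V : H} {n : ℕ} {s : ℕ → ℕ → H}
    (hs : ∀ i < n, ∀ j, V ≤ s i j ⊔ (s i j)ᶜ) : ∃ z, IsBrw V z ∧ IsApproxOfData V n s z := by
  have key : ∀ k, ∃ a : Code H, IsBrw V a ∧
      ∀ m, V ⊓ countVal n s k m ≤ eqVal a (.add (.mulNat .omega m) (.ofNat k)) := by
    refine fun k => exists_amalgamation (countVal n s k) _ (le_iSup_countVal hs k)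
      (fun m => (IsBrw.mulNat_omega _ m).add_ofNat k) fun m m' => ?_
    rcases le_or_gt m m' with hm | hm
    · exact mulNat_omega_add_ofNat_le _ hm le_rfl
    · rw [← le_leVal_iff,
        inf_countVal_inf_countVal_eq_bot le_rfl (fun i _ => inf_le_right) hm]
      exact bot_le
  choose g hg hgc using key
  have hlim : IsBrw V (.lim g) := by
    refine .lim hg fun k => ?_
    exact le_of_countVal (j := 1) le_rfl
      (fun i _ => inf_le_right.trans (upSeq_mono _ (Nat.le_succ k))) le_rfl
      (le_iSup_countVal hs k) (le_iSup_countVal hs (k + 1)) (hgc k) (hgc (k + 1))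
  exact ⟨_, hlim, g, hlim, hgc, le_eqVal_iff.2 ⟨hlim.le_refl, hlim.le_refl⟩⟩

/-- Finite choice: by induction, finitely many local existence statements hold on a common cover. -/
theorem le_sSup_semiDecData {U : H} {P : ℕ → H} (hU : U ≤ ⨅ n, semiDec (P n)) (n : ℕ) :
    U ≤ sSup {V | ∃ s : ℕ → ℕ → H, ∀ i < n, IsSemiDecData V (s i) (P i)} := by
  induction n with
  | zero => exact le_sSup ⟨fun _ _ => ⊥, fun i hi => absurd hi i.not_lt_zero⟩
  | succ n ih =>
    refine (le_inf ih (hU.trans (iInf_le _ n))).trans ?_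
    rw [semiDec, sSup_inf_sSup]
    refine iSup₂_le ?_
    rintro ⟨V, W⟩ ⟨⟨s, hs⟩, t, ht⟩
    refine le_sSup ⟨Function.update s n t, fun i hi => ?_⟩
    rcases Nat.lt_succ_iff_lt_or_eq.1 hi with hi | rfl
    · rw [Function.update_of_ne hi.ne]
      exact (hs i hi).mono inf_le_left
    · rw [Function.update_self]
      exact ht.mono inf_le_right

/-- The ordinals built from all local choices of data agree on overlaps, so they glue to one
section. -/
theorem exists_approx {U : H} {P : ℕ → H} (hU : U ≤ ⨅ n, semiDec (P n)) (n : ℕ) :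
    ∃ z, IsBrw U z ∧ ∀ V, (∃ s : ℕ → ℕ → H, ∀ i < n, IsSemiDecData V (s i) (P i)) →
      ∃ s : ℕ → ℕ → H, (∀ i < n, IsSemiDecData (U ⊓ V) (s i) (P i)) ∧
        IsApproxOfData (U ⊓ V) n s z := by
  let D : Set H := {V | ∃ s : ℕ → ℕ → H, ∀ i < n, IsSemiDecData V (s i) (P i)}
  choose s hs using fun V : D => V.2
  choose c hc hcs using fun V : D => exists_isApproxOfData fun i hi => (hs V i hi).1
  obtain ⟨z, hz, hzc⟩ := exists_amalgamation (U := U) (fun V : D => (V : H)) c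
    ((le_sSup_semiDecData hU n).trans_eq (sSup_eq_iSup' _)) (fun V => (hc V).mono inf_le_right)
    fun V W => by
      have h₁ : U ⊓ V ⊓ W ≤ V := inf_le_left.trans inf_le_right
      have h₂ : U ⊓ V ⊓ W ≤ W := inf_le_right
      exact IsApproxOfData.le le_rfl (fun i hi => (hs V i hi).mono h₁)
        (fun i hi => (hs W i hi).mono h₂)
        ((hcs V).congr h₁ (le_eqVal_iff.2 ⟨((hc V).mono h₁).le_refl, ((hc V).mono h₁).le_refl⟩))
        ((hcs W).congr h₂ (le_eqVal_iff.2 ⟨((hc W).mono h₂).le_refl, ((hc W).mono h₂).le_refl⟩))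
  exact ⟨z, hz, fun V hV => ⟨s ⟨V, hV⟩, fun i hi => (hs ⟨V, hV⟩ i hi).mono inf_le_right,
    (hcs ⟨V, hV⟩).congr inf_le_right (hzc ⟨V, hV⟩)⟩⟩

theorem exists_isCharOrd {U : H} {P : ℕ → H} (hU : U ≤ ⨅ n, semiDec (P n)) :
    ∃ y, IsBrw U y ∧ IsCharOrd U P y := by
  choose z hz hzs using exists_approx hU
  have hcov : ∀ n, U ≤ ⨆ V ∈ {V | ∃ s : ℕ → ℕ → H, ∀ i < n, IsSemiDecData V (s i) (P i)},
      U ⊓ V := fun n => by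
    rw [← inf_sSup_eq]
    exact le_inf le_rfl (le_sSup_semiDecData hU n)
  have hmono : ∀ n, Le U (z n) (z (n + 1)) := fun n => by
    rw [← le_leVal_iff]
    refine (hcov (n + 1)).trans (iSup₂_le fun V hV => le_leVal_iff.2 ?_)
    obtain ⟨s', hs', hz'⟩ := hzs (n + 1) V hV
    obtain ⟨t, ht⟩ := hV
    obtain ⟨s, hs, hz⟩ := hzs n V ⟨t, fun i hi => ht i (hi.trans n.lt_succ_self)⟩
    exact hz.le n.le_succ hs hs' hz'
  have hlim : IsBrw U (.lim fun n => (z n).add (.ofNat n)) :=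
    .lim (fun n => (hz n).add_ofNat n) fun n => (hmono n).add_ofNat (n + 1)
  refine ⟨_, hlim, z, fun n => ?_, hlim, le_eqVal_iff.2 ⟨hlim.le_refl, hlim.le_refl⟩⟩
  exact (hcov n).trans (iSup₂_le fun V hV => le_sSup (hzs n V hV))

theorem approxVal_inf_le_leVal {P : ℕ → H} {i n : ℕ} (hi : i < n) (z : Code H) :
    approxVal P n z ⊓ P i ≤ leVal (.mulNat .omega 2) z := by
  rw [approxVal, sSup_inf_eq]
  refine iSup₂_le ?_
  rintro V ⟨s, hs, g, hg, hc, hz⟩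
  refine (le_inf inf_le_left (hs i hi).inf_le_iSup).trans ?_
  rw [inf_iSup_eq]
  refine iSup_le fun j => le_leVal_iff.2 ?_
  have hW : V ⊓ s i j ≤ V := inf_le_left
  refine .trans (.lim_le (IsBrw.mulNat_omega _ 2) fun k => ?_) ((le_eqVal_iff.1 hz).2.mono hW)
  -- Bit `i` is `1` from stage `j` on, so the term at `k + j` is at least `ω + (k + j)`, which
  -- bounds `ω + k`.
  refine .le_lim (k + j) (hg.mono hW) (le_leVal_iff.1 ?_)
  refine le_of_inf_countVal_le
    (hW.trans (le_iSup_countVal (fun i hi => (hs i hi).1) (k + j))) fun m => ?_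
  rcases Nat.eq_zero_or_pos m with rfl | hm
  · refine le_trans (le_inf ?_ (inf_le_right.trans (countVal_zero_le s (k + j) hi)))
      ((inf_compl_self _).trans_le bot_le)
    exact inf_le_left.trans (inf_le_right.trans
      ((le_upSeq (s i) j).trans (upSeq_mono _ (Nat.le_add_left j k))))
  · exact le_leVal_iff.2 ((mulNat_omega_add_ofNat_le _ hm (Nat.le_add_right k j)).trans
      (le_eqVal_iff.1 ((inf_le_inf_right _ hW).trans (hc (k + j) m))).2)

theorem approxVal_inf_leSem_le (P : ℕ → H) (n : ℕ) (z : Code H) :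
    approxVal P n z ⊓ (Code.mulNat .omega 2).leSem z ≤ ⨆ i, P i := by
  rw [approxVal, sSup_inf_eq]
  refine iSup₂_le ?_
  rintro V ⟨s, hs, g, hg, hc, hz⟩
  -- The summand `1` makes the left side a successor, so that being below a limit yields a term.
  have h₁ : V ⊓ (Code.mulNat .omega 2).leSem z ≤
      ((Code.mulNat .omega 1).add (.ofNat 1)).leSem (.lim g) :=
    (le_inf inf_le_right (inf_le_left.trans (le_eqVal_iff.1 hz).1.le_leSem)).trans
      ((leSem_trans _ _ _).trans (leSem_add_omega_le _ _ 1))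
  refine (le_inf inf_le_left h₁).trans ?_
  refine (inf_iSup_eq V fun k =>
    ((Code.mulNat .omega 1).add (.ofNat 1)).leSem (g k)).trans_le (iSup_le fun k => ?_)
  refine le_of_inf_countVal_le
    (inf_le_left.trans (le_iSup_countVal (fun i hi => (hs i hi).1) k)) fun m => ?_
  rcases Nat.eq_zero_or_pos m with rfl | hm
  · have h₂ := (le_eqVal_iff.1 (hc k 0)).1.le_leSem
    refine le_trans ?_ bot_le
    refine le_trans (le_inf (inf_le_left.trans (inf_le_right.trans (leSem_suc_le _ _)))
      ((inf_le_inf_right _ inf_le_left).trans h₂)) ((leSem_trans _ _ _).trans ?_)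
    have h₃ : (Code.mulNat .omega 1 : Code H) = .omega :=
      congrArg Code.lim (funext zero_add_ofNat)
    have h₄ : Code.add (Code.mulNat .omega 0 : Code H) (.ofNat k) = .ofNat k := zero_add_ofNat k
    change (Code.mulNat .omega 1 : Code H).leSem _ ≤ _
    rw [h₃, h₄, leSem_omega_ofNat]
  · refine (le_inf (inf_le_left.trans inf_le_left)
      (inf_le_right.trans (countVal_le_iSup s k hm.ne'))).trans ?_
    rw [inf_iSup₂_eq]
    exact iSup₂_le fun i hi =>
      ((hs i (Finset.mem_range.1 hi)).inf_upSeq_le k).trans (le_iSup P i)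

theorem IsCharOrd.le_bihimp {U : H} {P : ℕ → H} {y : Code H} (h : IsCharOrd U P y) :
    U ≤ (⨆ n, P n) ⇔ leVal (Code.mulNat .omega 3) y := by
  obtain ⟨z, hz, hlim, hy⟩ := h
  obtain ⟨hy₁, hy₂⟩ := le_eqVal_iff.1 hy
  rw [le_bihimp_iff, inf_comm _ U, inf_comm _ U, and_comm]
  constructor
  · rw [inf_iSup_eq]
    refine iSup_le fun i => le_leVal_iff.2 ?_
    have hW : U ⊓ P i ≤ U := inf_le_left
    refine .trans (.lim_le (IsBrw.mulNat_omega _ 3) fun j => ?_) (hy₂.mono hW)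
    -- The index must exceed `i` for `P i` to be counted, and be at least `j` for the finite
    -- summand.
    refine .le_lim (i + 1 + j) (hlim.mono hW) ?_
    have h₁ : Le (U ⊓ P i) (.mulNat .omega 2) (z (i + 1 + j)) := le_leVal_iff.1
      ((inf_le_inf_right _ (hz _)).trans (approxVal_inf_le_leVal (by omega) _))
    exact ((IsBrw.mulNat_omega _ 2).add_ofNat_le (by omega)).trans (h₁.add_ofNat _)
  · have h₁ : U ⊓ leVal (.mulNat .omega 3) y ≤
        ((Code.mulNat .omega 2).add (.ofNat 1)).leSem
          (.lim fun n => (z n).add (.ofNat n)) :=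
      (le_inf (inf_le_right.trans (leVal_le_leSem _ _))
        (inf_le_left.trans hy₁.le_leSem)).trans
        ((leSem_trans _ _ _).trans (leSem_add_omega_le _ _ 1))
    refine (le_inf inf_le_left h₁).trans ?_
    refine (inf_iSup_eq U fun n => ((Code.mulNat .omega 2).add (.ofNat 1)).leSem
      ((z n).add (.ofNat n))).trans_le (iSup_le fun n => ?_)
    refine le_trans (inf_le_inf (hz n) ?_) (approxVal_inf_leSem_le P n (z n))
    exact (leSem_suc_le _ _).trans (leSem_add_omega_add_ofNat_le (Code.mulNat .omega 1) (z n) n)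

end Approximation

end SheafBrw

open scoped symmDiff in
open SheafBrw in
/-- In the logic of sheaves over any frame `H`: for every family `P` of propositions, if all `P n`
are semidecidable, then `∃ n, P n` is `(ω · 3)`-decidable; and the characteristic ordinal of `P`
exists and is a witness. -/
theorem theorem7p10 {H : Type*} [Order.Frame H] (P : ℕ → H) :
    (⨅ n, semiDec (P n)) ≤ ordDec (Code.mulNat Code.omega 3) (⨆ n, P n) ∧
      ∀ U : H, U ≤ ⨅ n, semiDec (P n) →
        (∃ y : Code H, IsCharOrd U P y) ∧
          ∀ y : Code H, IsCharOrd U P y →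
            U ≤ (⨆ n, P n) ⇔ leVal (Code.mulNat Code.omega 3) y := by
  refine ⟨?_, fun U hU => ⟨?_, fun y hy => hy.le_bihimp⟩⟩
  · obtain ⟨y, hy, hyc⟩ := exists_isCharOrd (le_refl (⨅ n, semiDec (P n)))
    exact le_sSup ⟨y, hy, hyc.le_bihimp⟩
  · obtain ⟨y, -, hy⟩ := exists_isCharOrd hU
    exact ⟨y, hy⟩
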